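/- Let $\alpha=\frac{\sqrt5-1}{2}$. The Kakutani–Fibonacci transformation $T:[0,1[\,\to[0,1[$ is the map given by $$T(x)=x+\alpha\quad\text{if }x\in I_1=[0,\alpha^2[,$$ and, for every $k\ge1$, $$T(x)=x+\alpha^{2k}-\sum_{j=0}^{k-1}\alpha^{2j+1}\quad\text{if }x\in I_{2k}=\Big[\sum_{j=0}^{k-1}\alpha^{2j+1},\ \sum_{j=0}^{k}\alpha^{2j+1}\Big[,$$ $$T(x)=x+\alpha^{2k+1}-\sum_{j=0}^{k-1}\alpha^{2(j+1)}\quad\text{if }x\in I_{2k+1}=\Big[\sum_{j=0}^{k-1}\alpha^{2(j+1)},\ \sum_{j=0}^{k}\alpha^{2(j+1)}\Big[.$$ (The intervals $I_k$, $k\ge1$, partition $[0,1[$.) Theorem. $T$ is uniquely ergodic, that is, there is exactly one Borel probability measure on $[0,1[$ that is invariant under $T$; this measure is Lebesgue measure. Consequently, for every $x\in[0,1[$ the orbit $(T^nx)_{n\ge0}$ is uniformly distributed in $[0,1[$: for all $0\le a<b\le1$, $$\lim_{N\to\infty}\frac1N\,\#\{0\le n<N:\ T^nx\in[a,b[\}=b-a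 .$$ -/

import Mathlib

open MeasureTheory Filter Topology

noncomputable section

namespace KakutaniFibonacci

/-- The half-open unit interval `[0,1[`, with its Borel σ-algebra. -/
abbrev UnitIco : Type := Set.Ico (0 : ℝ) 1

/-- Lebesgue measure on `[0,1[`. -/
def lebesgue : Measure UnitIco := (volume : Measure ℝ).comap Subtype.val

/-- `α = (√5 - 1) / 2`, the inverse of the golden ratio. -/
def α : ℝ := (√5 - 1) / 2

/-- Left endpoint of the `k`-th exchanged interval: `∑_{j<m} α^(2j+1)` if `k = 2m`, and
`∑_{j<m} α^(2(j+1))` if `k = 2m+1`. -/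
def leftEnd (k : ℕ) : ℝ :=
  if Even k then ∑ j ∈ Finset.range (k / 2), α ^ (2 * j + 1)
  else ∑ j ∈ Finset.range (k / 2), α ^ (2 * (j + 1))

/-- The `k`-th exchanged interval `I_k` (used for `k ≥ 1`). Its right endpoint is the sum defining
the left endpoint with one more term, so `I_1 = [0, α²[`, `I_2 = [α, α + α³[`,
`I_3 = [α², α² + α⁴[`, and so on. -/
def piece (k : ℕ) : Set ℝ := Set.Ico (leftEnd k) (leftEnd (k + 2))

lemma α_sq : α ^ 2 = 1 - α := by
  have h : √5 ^ 2 = 5 := Real.sq_sqrt (by norm_num)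
  unfold α
  nlinarith

lemma α_pos : 0 < α := by
  have h : (1 : ℝ) < √5 := by
    rw [Real.lt_sqrt (by norm_num)]
    norm_num
  unfold α
  linarith

lemma α_lt_one : α < 1 := by
  have := pow_pos α_pos 2
  linarith [α_sq]

lemma leftEnd_even (m : ℕ) : leftEnd (2 * m) = 1 - α ^ (2 * m) := by
  have h : leftEnd (2 * m) = ∑ j ∈ Finset.range m, α ^ (2 * j + 1) := by
    simp [leftEnd]
  rw [h]
  clear h
  induction m with
  | zero => simp
  | succ m ih =>
    rw [Finset.sum_range_succ, ih, show 2 * (m + 1) = 2 * m + 2 by ring, pow_add α (2 * m) 2, α_sq]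
    ring

lemma leftEnd_odd (m : ℕ) : leftEnd (2 * m + 1) = α - α ^ (2 * m + 1) := by
  have h : leftEnd (2 * m + 1) = ∑ j ∈ Finset.range m, α ^ (2 * (j + 1)) := by
    have h1 : ¬ Even (2 * m + 1) := by simp
    have h2 : (2 * m + 1) / 2 = m := by omega
    rw [leftEnd, if_neg h1, h2]
  rw [h]
  clear h
  induction m with
  | zero => simp
  | succ m ih =>
    rw [Finset.sum_range_succ, ih, show 2 * (m + 1) + 1 = 2 * m + 1 + 2 by ring,
      pow_add α (2 * m + 1) 2, α_sq]
    ring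

lemma leftEnd_add_two (k : ℕ) : leftEnd (k + 2) = leftEnd k + α ^ (k + 1) := by
  rcases Nat.even_or_odd' k with ⟨m, rfl | rfl⟩
  · rw [show 2 * m + 2 = 2 * (m + 1) by ring, leftEnd_even, leftEnd_even,
      show 2 * (m + 1) = 2 * m + 2 by ring, pow_add α (2 * m) 2, α_sq]
    ring
  · rw [show 2 * m + 1 + 2 = 2 * (m + 1) + 1 by ring, leftEnd_odd, leftEnd_odd,
      show 2 * (m + 1) + 1 = 2 * m + 1 + 2 by ring, pow_add α (2 * m + 1) 2, α_sq]
    ring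

/-- The gap between consecutive powers of `α²` into which a number in `(0, 1]` falls. -/
lemma exists_sq_pow {y : ℝ} (h0 : 0 < y) (h1 : y ≤ 1) :
    ∃ m : ℕ, α ^ (2 * m + 2) < y ∧ y ≤ α ^ (2 * m) := by
  have hpos : (0 : ℝ) < α ^ 2 := pow_pos α_pos 2
  have hlt : α ^ 2 < 1 := pow_lt_one₀ α_pos.le α_lt_one two_ne_zero
  obtain ⟨m, hm1, hm2⟩ := exists_nat_pow_near_of_lt_one h0 h1 hpos hlt
  refine ⟨m, ?_, ?_⟩
  · rw [show 2 * m + 2 = 2 * (m + 1) by ring, pow_mul]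
    exact hm1
  · rw [pow_mul]
    exact hm2

/-- The intervals `I_k`, `k ≥ 1`, cover `[0,1[`. -/
lemma exists_piece (x : UnitIco) : ∃ k : ℕ, 1 ≤ k ∧ (x : ℝ) ∈ piece k := by
  obtain ⟨x, hx0, hx1⟩ := x
  have hα := α_pos
  by_cases hx : x < α
  · have hy0 : 0 < (α - x) / α := div_pos (by linarith) hα
    have hy1 : (α - x) / α ≤ 1 := by
      rw [div_le_one hα]
      linarith
    obtain ⟨m, hm1, hm2⟩ := exists_sq_pow hy0 hy1
    rw [lt_div_iff₀ hα] at hm1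
    rw [div_le_iff₀ hα] at hm2
    refine ⟨2 * m + 1, by omega, ?_, ?_⟩
    · rw [leftEnd_odd, pow_succ]
      change _ ≤ x
      linarith
    · rw [show 2 * m + 1 + 2 = 2 * (m + 1) + 1 by ring, leftEnd_odd, pow_succ,
        show 2 * (m + 1) = 2 * m + 2 by ring]
      change x < _
      linarith
  · obtain ⟨m, hm1, hm2⟩ := exists_sq_pow (y := 1 - x) (by linarith) (by linarith)
    have hm : m ≠ 0 := by
      rintro rfl
      have : α ^ (2 * 0 + 2) = 1 - α := by
        rw [← α_sq]
      linarith
    refine ⟨2 * m, by omega, ?_, ?_⟩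
    · rw [leftEnd_even]
      change _ ≤ x
      linarith
    · rw [show 2 * m + 2 = 2 * (m + 1) by ring, leftEnd_even, show 2 * (m + 1) = 2 * m + 2 by ring]
      change x < _
      linarith

/-- The intervals `I_k`, `k ≥ 1`, are pairwise disjoint. -/
lemma piece_unique {x : ℝ} {k l : ℕ} (hk : 1 ≤ k) (hl : 1 ≤ l) (hxk : x ∈ piece k)
    (hxl : x ∈ piece l) : k = l := by
  have hanti : ∀ {i j : ℕ}, i ≤ j → α ^ j ≤ α ^ i := fun h =>
    pow_le_pow_of_le_one α_pos.le α_lt_one.le h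
  have hpos : ∀ i : ℕ, 0 < α ^ i := fun i => pow_pos α_pos i
  have hsq := α_sq
  have key : ∀ {a b : ℕ}, 1 ≤ a → 1 ≤ b → x ∈ piece a → x ∈ piece b → a < b → False := by
    intro a b ha hb hxa hxb hab
    obtain ⟨ha1, ha2⟩ := hxa
    obtain ⟨hb1, hb2⟩ := hxb
    rcases Nat.even_or_odd' a with ⟨m, rfl | rfl⟩ <;> rcases Nat.even_or_odd' b with ⟨n, rfl | rfl⟩
    · rw [show 2 * m + 2 = 2 * (m + 1) by ring, leftEnd_even] at ha2
      rw [leftEnd_even] at hb1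
      have := hanti (show 2 * (m + 1) ≤ 2 * n by omega)
      linarith
    · rw [leftEnd_even] at ha1
      rw [show 2 * n + 1 + 2 = 2 * (n + 1) + 1 by ring, leftEnd_odd] at hb2
      have := hanti (show 2 ≤ 2 * m by omega)
      have := hpos (2 * (n + 1) + 1)
      linarith
    · rw [leftEnd_even] at hb1
      rw [show 2 * m + 1 + 2 = 2 * (m + 1) + 1 by ring, leftEnd_odd] at ha2
      have := hanti (show 2 ≤ 2 * n by omega)
      have := hpos (2 * (m + 1) + 1)
      linarith
    · rw [show 2 * m + 1 + 2 = 2 * (m + 1) + 1 by ring, leftEnd_odd] at ha2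
      rw [leftEnd_odd] at hb1
      have := hanti (show 2 * (m + 1) + 1 ≤ 2 * n + 1 by omega)
      linarith
  rcases lt_trichotomy k l with h | h | h
  · exact (key hk hl hxk hxl h).elim
  · exact h
  · exact (key hl hk hxl hxk h).elim

lemma translate_mem {x : ℝ} {k : ℕ} (hk : 1 ≤ k) (hx : x ∈ piece k) :
    x + α ^ k - leftEnd k ∈ Set.Ico (0 : ℝ) 1 := by
  obtain ⟨h1, h2⟩ := hx
  rw [leftEnd_add_two] at h2
  have hpos : 0 < α ^ k := pow_pos α_pos k
  have e1 : α ^ k ≤ α ^ 1 := pow_le_pow_of_le_one α_pos.le α_lt_one.le hk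
  have e2 : α ^ (k + 1) ≤ α ^ 2 := pow_le_pow_of_le_one α_pos.le α_lt_one.le (by omega)
  rw [pow_one] at e1
  constructor
  · linarith
  · linarith [α_sq]

/-- The index `k ≥ 1` of the unique interval `I_k` that contains `x`. -/
def index (x : UnitIco) : ℕ := (exists_piece x).choose

lemma one_le_index (x : UnitIco) : 1 ≤ index x := (exists_piece x).choose_spec.1

lemma mem_piece_index (x : UnitIco) : (x : ℝ) ∈ piece (index x) := (exists_piece x).choose_spec.2

/-- The Kakutani–Fibonacci transformation of `[0,1[`: it translates each interval `I_k`, `k ≥ 1`,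
by `α ^ k - leftEnd k`, so that the left endpoint of `I_k` goes to `α ^ k`. -/
def T (x : UnitIco) : UnitIco :=
  ⟨(x : ℝ) + α ^ index x - leftEnd (index x), translate_mem (one_le_index x) (mem_piece_index x)⟩

/-- On `I_1 = [0, α²[` the transformation is `x ↦ x + α`. -/
lemma T_apply_one (x : UnitIco) (hx : (x : ℝ) ∈ Set.Ico 0 (α ^ 2)) : (T x : ℝ) = x + α := by
  have e1 : leftEnd 1 = 0 := by simp [leftEnd]
  have e3 : leftEnd (1 + 2) = α ^ 2 := by rw [leftEnd_add_two, e1, zero_add]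
  have hx' : (x : ℝ) ∈ piece 1 := by rwa [piece, e1, e3]
  have h : index x = 1 := piece_unique (one_le_index x) le_rfl (mem_piece_index x) hx'
  change (x : ℝ) + α ^ index x - leftEnd (index x) = _
  rw [h, e1]
  ring

/-- The transformation on the intervals of even index `2k`, `k ≥ 1`. -/
lemma T_apply_even (x : UnitIco) (k : ℕ) (hk : 1 ≤ k)
    (hx : (x : ℝ) ∈ Set.Ico (∑ j ∈ Finset.range k, α ^ (2 * j + 1))
      (∑ j ∈ Finset.range (k + 1), α ^ (2 * j + 1))) :
    (T x : ℝ) = x + α ^ (2 * k) - ∑ j ∈ Finset.range k, α ^ (2 * j + 1) := by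
  have e : ∀ m : ℕ, leftEnd (2 * m) = ∑ j ∈ Finset.range m, α ^ (2 * j + 1) := by
    intro m
    simp [leftEnd]
  have hx' : (x : ℝ) ∈ piece (2 * k) := by
    rwa [piece, show 2 * k + 2 = 2 * (k + 1) by ring, e, e]
  have h : index x = 2 * k := piece_unique (one_le_index x) (by omega) (mem_piece_index x) hx'
  change (x : ℝ) + α ^ index x - leftEnd (index x) = _
  rw [h, e]

/-- The transformation on the intervals of odd index `2k+1`. -/
lemma T_apply_odd (x : UnitIco) (k : ℕ)
    (hx : (x : ℝ) ∈ Set.Ico (∑ j ∈ Finset.range k, α ^ (2 * (j + 1)))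
      (∑ j ∈ Finset.range (k + 1), α ^ (2 * (j + 1)))) :
    (T x : ℝ) = x + α ^ (2 * k + 1) - ∑ j ∈ Finset.range k, α ^ (2 * (j + 1)) := by
  have e : ∀ m : ℕ, leftEnd (2 * m + 1) = ∑ j ∈ Finset.range m, α ^ (2 * (j + 1)) := by
    intro m
    have h1 : ¬ Even (2 * m + 1) := by simp
    have h2 : (2 * m + 1) / 2 = m := by omega
    rw [leftEnd, if_neg h1, h2]
  have hx' : (x : ℝ) ∈ piece (2 * k + 1) := by
    rwa [piece, show 2 * k + 1 + 2 = 2 * (k + 1) + 1 by ring, e, e]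
  have h : index x = 2 * k + 1 := piece_unique (one_le_index x) (by omega) (mem_piece_index x) hx'
  change (x : ℝ) + α ^ index x - leftEnd (index x) = _
  rw [h, e]

/-- The set of `S`-invariant probability measures of a transformation `S`
(measurability of `S` is part of `MeasurePreserving`). -/
def invariantMeasures {X : Type*} [MeasurableSpace X] (S : X → X) : Set (Measure X) :=
  {μ | IsProbabilityMeasure μ ∧ MeasurePreserving S μ μ}

/-- `S` is uniquely ergodic: it has exactly one invariant probability measure. -/
def UniquelyErgodic {X : Type*} [MeasurableSpace X] (S : X → X) : Prop :=
  ∃ μ : Measure X, invariantMeasures S = {μ}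

open Classical in
/-- A sequence in `[0,1[` is uniformly distributed: for every interval `[a,b[ ⊆ [0,1[`, the
proportion of the first `N` terms that lie in `[a,b[` tends to `b - a`. -/
def UniformlyDistributed (x : ℕ → UnitIco) : Prop :=
  ∀ a b : ℝ, 0 ≤ a → a < b → b ≤ 1 →
    Tendsto (fun N : ℕ =>
        (((Finset.range N).filter fun n => (x n : ℝ) ∈ Set.Ico a b).card : ℝ) / N)
      atTop (𝓝 (b - a))

end KakutaniFibonacci

end

namespace KakutaniFibonacci

/-! `T` is self-similar: its first return map to `[0,α[` is `T` itself rescaled by `α`, with return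
time 2 or 1 according as `y < α` or not (`iterate_T_shrink`). Summing the centred indicator of
`[0,t[` over an excursion therefore gives `centred s y - t * centred α y` for a new threshold `s`,
so Birkhoff sums of length about `N` reduce to sums of length about `αN`, up to a bounded error.

For `t = α` one has `s = 1`, the first term vanishes, and the sums are bounded
(`abs_birkhoffSum_α_le`). This controls the second term for every `t`; iterating gives `|S_N| ≤ α^k
N + C` with `C` depending only on `k`, so the averages tend to 0 uniformly in the point.
Equidistribution follows, and integrating against an invariant probability measure forces `[0,t[` to
have mass `t`. Lebesgue measure is invariant because `T` translates the pieces onto disjoint sets.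
-/

/-! ### Self-similarity of `T` -/

lemma T_of_mem_piece {x : UnitIco} {k : ℕ} (hk : 1 ≤ k) (hx : (x : ℝ) ∈ piece k) :
    (T x : ℝ) = x + α ^ k - leftEnd k := by
  have h : index x = k := piece_unique (one_le_index x) hk (mem_piece_index x) hx
  change (x : ℝ) + α ^ index x - leftEnd (index x) = _
  rw [h]

/-- The similarity `y ↦ α y` of `[0,1[` onto `[0,α[`. -/
noncomputable def shrink (y : UnitIco) : UnitIco :=
  ⟨α * y, mul_nonneg α_pos.le y.2.1, by nlinarith [α_pos, α_lt_one, y.2.1, y.2.2]⟩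

lemma coe_shrink (y : UnitIco) : (shrink y : ℝ) = α * y := rfl

/-- The time after which `shrink y` returns to `[0,α[` under `T`. -/
noncomputable def returnTime (y : UnitIco) : ℕ := if (y : ℝ) < α then 2 else 1

lemma leftEnd_odd_eq_mul (m : ℕ) : leftEnd (2 * m + 1) = α * leftEnd (2 * m) := by
  rw [leftEnd_odd, leftEnd_even, pow_succ]
  ring

lemma leftEnd_even_eq_mul (m : ℕ) : leftEnd (2 * m + 2) = α * leftEnd (2 * m + 1) + α := by
  rw [show 2 * m + 2 = 2 * (m + 1) by ring, leftEnd_odd, leftEnd_even,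
    show 2 * (m + 1) = 2 * m + 1 + 1 by ring, pow_succ]
  linear_combination -α_sq

lemma T_shrink_of_lt {y : UnitIco} (hy : (y : ℝ) < α) : (T (shrink y) : ℝ) = α * y + α := by
  refine T_apply_one _ ⟨(shrink y).2.1, ?_⟩
  rw [coe_shrink, sq]
  exact mul_lt_mul_of_pos_left hy α_pos

/-- The first return map of `T` to `[0,α[` is conjugate to `T` by a similarity. -/
lemma iterate_T_shrink (y : UnitIco) : T^[returnTime y] (shrink y) = shrink (T y) := by
  have hα := α_pos
  obtain ⟨k, hk, hy⟩ := exists_piece y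
  have hTy := T_of_mem_piece hk hy
  obtain ⟨h1, h2⟩ := hy
  apply Subtype.ext
  rw [coe_shrink, hTy]
  -- Scaling sends `I_{2m}` onto `I_{2m+1}`, which returns at once; it sends `I_{2m+1}` into `I_1`,
  -- and one step of `T` then leads into `I_{2m+2}`.
  rcases Nat.even_or_odd' k with ⟨m, rfl | rfl⟩
  · have hle : α ≤ y := by
      have : α ^ (2 * m) ≤ α ^ 2 := pow_le_pow_of_le_one hα.le α_lt_one.le (by omega)
      rw [leftEnd_even] at h1
      linarith [α_sq]
    rw [returnTime, if_neg hle.not_gt, Function.iterate_one,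
      T_of_mem_piece (k := 2 * m + 1) (by omega), leftEnd_odd_eq_mul, coe_shrink, pow_succ]
    · ring
    · constructor
      · rw [leftEnd_odd_eq_mul]
        exact mul_le_mul_of_nonneg_left h1 hα.le
      · rw [show 2 * m + 1 + 2 = 2 * (m + 1) + 1 by ring, leftEnd_odd_eq_mul]
        exact mul_lt_mul_of_pos_left h2 hα
  · have hlt : (y : ℝ) < α := by
      rw [show 2 * m + 1 + 2 = 2 * (m + 1) + 1 by ring, leftEnd_odd] at h2
      linarith [pow_pos hα (2 * (m + 1) + 1)]
    rw [returnTime, if_pos hlt, Function.iterate_succ_apply, Function.iterate_one,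
      T_of_mem_piece (k := 2 * m + 2) (by omega), leftEnd_even_eq_mul, T_shrink_of_lt hlt,
      pow_succ α (2 * m + 1)]
    · ring
    · rw [T_shrink_of_lt hlt]
      constructor
      · rw [leftEnd_even_eq_mul]
        linarith [mul_le_mul_of_nonneg_left h1 hα.le]
      · rw [show 2 * m + 2 + 2 = 2 * (m + 1) + 2 by ring, leftEnd_even_eq_mul]
        exact add_lt_add_left (mul_lt_mul_of_pos_left h2 hα) α

/-- An orbit never spends two consecutive steps outside `[0,α[`, so one step suffices to enter it.
-/
lemma T_lt_of_le {x : UnitIco} (hx : α ≤ x) : (T x : ℝ) < α := by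
  obtain ⟨k, hk, h⟩ := exists_piece x
  rw [T_of_mem_piece hk h]
  obtain ⟨h1, h2⟩ := h
  rcases Nat.even_or_odd' k with ⟨m, rfl | rfl⟩
  · rw [leftEnd_add_two, pow_succ] at h2
    have : α ^ (2 * m) ≤ α ^ 2 := pow_le_pow_of_le_one α_pos.le α_lt_one.le (by omega)
    nlinarith [α_sq, α_pos]
  · rw [show 2 * m + 1 + 2 = 2 * (m + 1) + 1 by ring, leftEnd_odd] at h2
    linarith [pow_pos α_pos (2 * (m + 1) + 1)]

lemma exists_shrink_eq {x : UnitIco} (hx : (x : ℝ) < α) : ∃ y, shrink y = x :=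
  ⟨⟨x / α, div_nonneg x.2.1 α_pos.le, (div_lt_one α_pos).2 hx⟩,
    Subtype.ext (mul_div_cancel₀ _ α_pos.ne')⟩

/-! ### Cutting orbits into excursions -/

/-- The time that `shrink y` needs for its first `M` returns to `[0,α[`. -/
noncomputable def totalTime (M : ℕ) (y : UnitIco) : ℕ :=
  ∑ m ∈ Finset.range M, returnTime (T^[m] y)

lemma totalTime_succ (M : ℕ) (y : UnitIco) :
    totalTime (M + 1) y = totalTime M y + returnTime (T^[M] y) := Finset.sum_range_succ _ _

lemma iterate_totalTime (M : ℕ) (y : UnitIco) :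
    T^[totalTime M y] (shrink y) = shrink (T^[M] y) := by
  induction M with
  | zero => rfl
  | succ M ih =>
    rw [totalTime_succ, add_comm, Function.iterate_add_apply, ih, iterate_T_shrink,
      Function.iterate_succ_apply']

lemma birkhoffSum_totalTime (g : UnitIco → ℝ) (M : ℕ) (y : UnitIco) :
    birkhoffSum T g (totalTime M y) (shrink y) =
      birkhoffSum T (fun z => birkhoffSum T g (returnTime z) (shrink z)) M y := by
  induction M with
  | zero => simp [totalTime]
  | succ M ih =>
    rw [totalTime_succ, birkhoffSum_add, ih, birkhoffSum_succ, iterate_totalTime]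

lemma exists_totalTime (N : ℕ) (y : UnitIco) :
    ∃ M, totalTime M y = N ∨ totalTime M y + 1 = N ∧ returnTime (T^[M] y) = 2 := by
  induction N with
  | zero => exact ⟨0, Or.inl rfl⟩
  | succ N ih =>
    obtain ⟨M, h | ⟨h, h2⟩⟩ := ih
    · by_cases hr : returnTime (T^[M] y) = 2
      · exact ⟨M, Or.inr ⟨by omega, hr⟩⟩
      · have : returnTime (T^[M] y) = 1 := by
          unfold returnTime at hr ⊢
          split_ifs at hr ⊢ <;> simp_all
        exact ⟨M + 1, Or.inl (by rw [totalTime_succ]; omega)⟩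
    · exact ⟨M + 1, Or.inl (by rw [totalTime_succ]; omega)⟩

/-- Every orbit segment consists of complete excursions from `[0,α[`, up to at most one point at
either end. -/
lemma exists_excursions (N : ℕ) (x : UnitIco) :
    ∃ M y, totalTime M y ≤ N ∧ ∀ g : UnitIco → ℝ, (∀ z, |g z| ≤ 1) →
      |birkhoffSum T g N x - birkhoffSum T g (totalTime M y) (shrink y)| ≤ 2 := by
  have aux : ∀ (N : ℕ) (y : UnitIco), ∃ M, totalTime M y ≤ N ∧
      ∀ g : UnitIco → ℝ, (∀ z, |g z| ≤ 1) →
      |birkhoffSum T g N (shrink y) - birkhoffSum T g (totalTime M y) (shrink y)| ≤ 1 := by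
    intro N y
    obtain ⟨M, h | ⟨h, -⟩⟩ := exists_totalTime N y
    · exact ⟨M, h.le, fun g _ => by simp [h]⟩
    · refine ⟨M, by omega, fun g hg => ?_⟩
      rw [← h, birkhoffSum_succ, add_sub_cancel_left]
      exact hg _
  by_cases hx : (x : ℝ) < α
  · obtain ⟨y, rfl⟩ := exists_shrink_eq hx
    obtain ⟨M, h, hM⟩ := aux N y
    exact ⟨M, y, h, fun g hg => (hM g hg).trans (by norm_num)⟩
  · rcases N with _ | N
    · exact ⟨0, x, le_rfl, fun g _ => by simp [totalTime]⟩
    · obtain ⟨y, hy⟩ := exists_shrink_eq (T_lt_of_le (not_lt.1 hx))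
      obtain ⟨M, h, hM⟩ := aux N y
      refine ⟨M, y, by omega, fun g hg => ?_⟩
      rw [birkhoffSum_succ', ← hy, add_sub_assoc]
      linarith [abs_add_le (g x) (birkhoffSum T g N (shrink y) -
        birkhoffSum T g (totalTime M y) (shrink y)), hg x, hM g hg]

/-! ### Renormalization of Birkhoff sums -/

/-- The centred indicator function of `[0,t[`. -/
noncomputable def centred (t : ℝ) (x : UnitIco) : ℝ := (if (x : ℝ) < t then 1 else 0) - t

lemma abs_centred_le {t : ℝ} (h0 : 0 ≤ t) (h1 : t ≤ 1) (x : UnitIco) : |centred t x| ≤ 1 := by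
  unfold centred
  split_ifs <;> rw [abs_le] <;> constructor <;> linarith

lemma centred_one (x : UnitIco) : centred 1 x = 0 := by
  simp [centred, x.2.2]

/-- The sum of `centred t` over an excursion, when `t ≤ α`. -/
lemma birkhoffSum_returnTime_of_le {t : ℝ} (ht : t ≤ α) (y : UnitIco) :
    birkhoffSum T (centred t) (returnTime y) (shrink y) =
      centred (t / α) y - t * centred α y := by
  have hα := α_pos
  -- Since `1 / α = 1 + α` is the mean return time, the constants cancel, leaving only the
  -- fluctuation `-t * centred α y`.
  have hdiv : t / α = t * (1 + α) := by
    rw [div_eq_iff hα.ne']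
    linear_combination -t * α_sq
  have e : ((shrink y : ℝ) < t) ↔ (y : ℝ) < t / α := by
    rw [coe_shrink, lt_div_iff₀' hα]
  by_cases hy : (y : ℝ) < α
  · have hn : ¬ (T (shrink y) : ℝ) < t := by
      rw [T_shrink_of_lt hy]
      nlinarith [y.2.1]
    rw [returnTime, if_pos hy, birkhoffSum_succ, birkhoffSum_one, Function.iterate_one]
    simp only [centred, e, hn, hy, if_true, if_false]
    rw [hdiv]
    ring
  · rw [returnTime, if_neg hy, birkhoffSum_one]
    simp only [centred, e, hy, if_false]
    rw [hdiv]
    ring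

/-- The sum of `centred t` over an excursion, when `α < t ≤ 1`. -/
lemma birkhoffSum_returnTime_of_lt {t : ℝ} (ht : α < t) (ht1 : t ≤ 1) (y : UnitIco) :
    birkhoffSum T (centred t) (returnTime y) (shrink y) =
      centred ((t - α) / α) y - t * centred α y := by
  have hα := α_pos
  have hdiv : (t - α) / α = t * (1 + α) - 1 := by
    rw [div_eq_iff hα.ne']
    linear_combination -t * α_sq
  have hx : (shrink y : ℝ) < t := by
    rw [coe_shrink]
    nlinarith [y.2.2]
  by_cases hy : (y : ℝ) < α
  · have e : ((T (shrink y) : ℝ) < t) ↔ (y : ℝ) < (t - α) / α := by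
      rw [T_shrink_of_lt hy, lt_div_iff₀' hα, lt_sub_iff_add_lt]
    rw [returnTime, if_pos hy, birkhoffSum_succ, birkhoffSum_one, Function.iterate_one]
    simp only [centred, e, hx, hy, if_true]
    rw [hdiv]
    ring
  · have hn : ¬ (y : ℝ) < (t - α) / α := by
      rw [lt_div_iff₀' hα]
      nlinarith [α_sq]
    rw [returnTime, if_neg hy, birkhoffSum_one]
    simp only [centred, hx, hn, hy, if_true, if_false]
    rw [hdiv]
    ring

lemma exists_birkhoffSum_totalTime {t : ℝ} (h0 : 0 ≤ t) (h1 : t ≤ 1) :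
    ∃ s, 0 ≤ s ∧ s ≤ 1 ∧ ∀ M y, birkhoffSum T (centred t) (totalTime M y) (shrink y) =
      birkhoffSum T (centred s) M y - t * birkhoffSum T (centred α) M y := by
  have hα := α_pos
  rcases le_or_gt t α with ht | ht
  · refine ⟨t / α, div_nonneg h0 hα.le, (div_le_one hα).2 ht, fun M y => ?_⟩
    simp only [birkhoffSum_totalTime, birkhoffSum_returnTime_of_le ht]
    simp only [birkhoffSum, Finset.sum_sub_distrib, Finset.mul_sum]
  · refine ⟨(t - α) / α, div_nonneg (by linarith) hα.le, ?_, fun M y => ?_⟩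
    · rw [div_le_one hα]
      nlinarith [α_sq, sq_nonneg (2 * α - 1)]
    · simp only [birkhoffSum_totalTime, birkhoffSum_returnTime_of_lt ht h1]
      simp only [birkhoffSum, Finset.sum_sub_distrib, Finset.mul_sum]

/-- The new threshold is `α / α = 1`, whose centred indicator vanishes; only a contraction by `-α`
remains. -/
lemma birkhoffSum_α_totalTime (M : ℕ) (y : UnitIco) :
    birkhoffSum T (centred α) (totalTime M y) (shrink y) =
      -(α * birkhoffSum T (centred α) M y) := by
  simp only [birkhoffSum_totalTime, birkhoffSum_returnTime_of_le le_rfl, div_self α_pos.ne',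
    centred_one]
  simp only [birkhoffSum, zero_sub, Finset.sum_neg_distrib, Finset.mul_sum]

/-- The return time is affine in `centred α`, so bounded discrepancy of `[0,α[` will give `M ≤ αN +
O(1)`. -/
lemma mul_totalTime (M : ℕ) (y : UnitIco) :
    α * totalTime M y = M + α * birkhoffSum T (centred α) M y := by
  have h : ∀ z, (returnTime z : ℝ) = 1 + α + centred α z := by
    intro z
    unfold returnTime centred
    split_ifs <;> push_cast <;> ring
  rw [totalTime, birkhoffSum, Nat.cast_sum]
  simp only [h, Finset.sum_add_distrib, Finset.sum_const, Finset.card_range, nsmul_eq_mul]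
  linear_combination (M : ℝ) * α_sq

lemma le_totalTime (M : ℕ) (y : UnitIco) : M ≤ totalTime M y := by
  have : ∑ _m ∈ Finset.range M, 1 ≤ totalTime M y := by
    refine Finset.sum_le_sum fun m _ => ?_
    unfold returnTime
    split_ifs <;> norm_num
  simpa using this

/-! ### Uniform bounds and equidistribution -/

lemma abs_birkhoffSum_le_card {g : UnitIco → ℝ} (hg : ∀ z, |g z| ≤ 1) (N : ℕ) (x : UnitIco) :
    |birkhoffSum T g N x| ≤ N := by
  have : |birkhoffSum T g N x| ≤ ∑ _n ∈ Finset.range N, (1 : ℝ) :=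
    (Finset.abs_sum_le_sum_abs _ _).trans (Finset.sum_le_sum fun n _ => hg _)
  simpa using this

/-- The interval `[0,α[` has bounded discrepancy. -/
lemma abs_birkhoffSum_α_le (N : ℕ) (x : UnitIco) : |birkhoffSum T (centred α) N x| ≤ 6 := by
  have hα := α_pos
  -- This makes 6 stable under renormalization: `2 + 6α ≤ 6`, the 2 coming from the ends of the
  -- segment.
  have hα' : α ≤ 2 / 3 := by nlinarith [α_sq]
  have hb := abs_centred_le hα.le α_lt_one.le
  -- Each renormalization improves the trivial bound `N` by a factor `α`; letting `k → ∞` removes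
  -- the linear term.
  have key : ∀ k N x, |birkhoffSum T (centred α) N x| ≤ α ^ k * (N : ℝ) + 6 := by
    intro k
    induction k with
    | zero => exact fun N x => by linarith [abs_birkhoffSum_le_card hb N x]
    | succ k ih =>
      intro N x
      obtain ⟨M, y, hN, hM⟩ := exists_excursions N x
      have h1 := hM _ hb
      rw [birkhoffSum_α_totalTime, sub_neg_eq_add] at h1
      have h2 := mul_le_mul_of_nonneg_left (ih M y) hα.le
      rw [← abs_of_pos hα, ← abs_mul, abs_of_pos hα] at h2
      have h3 : (M : ℝ) ≤ N := by exact_mod_cast (le_totalTime M y).trans hN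
      have h4 := mul_le_mul_of_nonneg_left h3 (pow_pos hα (k + 1)).le
      have h5 := abs_sub (birkhoffSum T (centred α) N x + α * birkhoffSum T (centred α) M y)
        (α * birkhoffSum T (centred α) M y)
      rw [add_sub_cancel_right] at h5
      rw [pow_succ] at h4 ⊢
      linarith
  have hlim : Tendsto (fun k : ℕ => α ^ k * (N : ℝ) + 6) atTop (𝓝 (0 * (N : ℝ) + 6)) :=
    ((tendsto_pow_atTop_nhds_zero_of_lt_one hα.le α_lt_one).mul_const _).add_const _
  simpa using ge_of_tendsto' hlim fun k => key k N x

lemma exists_abs_birkhoffSum_le_pow (k : ℕ) : ∃ C : ℝ, ∀ t : ℝ, 0 ≤ t → t ≤ 1 → ∀ N x,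
    |birkhoffSum T (centred t) N x| ≤ α ^ k * (N : ℝ) + C := by
  have hα := α_pos
  induction k with
  | zero =>
    exact ⟨0, fun t h0 h1 N x => by
      linarith [abs_birkhoffSum_le_card (abs_centred_le h0 h1) N x]⟩
  | succ k ih =>
    obtain ⟨C, hC⟩ := ih
    -- 14 = 2 (ends of the segment) + 6 (the `centred α` term) + 6 (from `M ≤ αN + 6`).
    refine ⟨C + 14, fun t h0 h1 N x => ?_⟩
    obtain ⟨M, y, hN, hM⟩ := exists_excursions N x
    obtain ⟨s, hs0, hs1, hs⟩ := exists_birkhoffSum_totalTime h0 h1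
    have e1 := hM _ (abs_centred_le h0 h1)
    rw [hs] at e1
    have e2 := hC s hs0 hs1 M y
    have e3 := abs_birkhoffSum_α_le M y
    have e4 : |t * birkhoffSum T (centred α) M y| ≤ 6 := by
      rw [abs_mul, abs_of_nonneg h0]
      nlinarith [abs_nonneg (birkhoffSum T (centred α) M y)]
    have e5 : (M : ℝ) ≤ α * N + 6 := by
      have h := mul_totalTime M y
      have h' : α * (totalTime M y : ℝ) ≤ α * N :=
        mul_le_mul_of_nonneg_left (by exact_mod_cast hN) hα.le
      nlinarith [(abs_le.1 e3).1, α_lt_one]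
    have e6 : α ^ k * (M : ℝ) ≤ α ^ (k + 1) * N + 6 := by
      have h := mul_le_mul_of_nonneg_left e5 (pow_pos hα k).le
      have h' : α ^ k ≤ 1 := pow_le_one₀ hα.le α_lt_one.le
      rw [pow_succ]
      linarith
    rw [abs_le] at *
    constructor <;> linarith [e1.1, e1.2, e2.1, e2.2, e4.1, e4.2]

/-- Birkhoff averages of `centred t` tend to zero, uniformly in the starting point. -/
lemma exists_abs_birkhoffSum_le {ε : ℝ} (hε : 0 < ε) : ∃ C : ℝ, ∀ t : ℝ, 0 ≤ t → t ≤ 1 → ∀ N x,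
    |birkhoffSum T (centred t) N x| ≤ ε * (N : ℝ) + C := by
  obtain ⟨k, hk⟩ := exists_pow_lt_of_lt_one hε α_lt_one
  obtain ⟨C, hC⟩ := exists_abs_birkhoffSum_le_pow k
  refine ⟨C, fun t h0 h1 N x => (hC t h0 h1 N x).trans ?_⟩
  have := mul_le_mul_of_nonneg_right hk.le (Nat.cast_nonneg (α := ℝ) N)
  linarith

lemma exists_abs_birkhoffAverage_le {ε : ℝ} (hε : 0 < ε) : ∃ N₀ : ℕ, 0 < N₀ ∧
    ∀ t : ℝ, 0 ≤ t → t ≤ 1 → ∀ N ≥ N₀, ∀ x, |birkhoffSum T (centred t) N x / N| ≤ ε := by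
  obtain ⟨C, hC⟩ := exists_abs_birkhoffSum_le (half_pos hε)
  obtain ⟨n, hn⟩ := exists_nat_gt (C / (ε / 2))
  refine ⟨n + 1, n.succ_pos, fun t h0 h1 N hN x => ?_⟩
  have hN' : (n : ℝ) + 1 ≤ N := by exact_mod_cast hN
  have hpos : (0 : ℝ) < N := by
    have := Nat.cast_nonneg (α := ℝ) n
    linarith
  rw [div_lt_iff₀ (half_pos hε)] at hn
  rw [abs_div, abs_of_pos hpos, div_le_iff₀ hpos]
  nlinarith [hC t h0 h1 N x]

lemma tendsto_birkhoffSum_div {t : ℝ} (h0 : 0 ≤ t) (h1 : t ≤ 1) (x : UnitIco) :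
    Tendsto (fun N : ℕ => birkhoffSum T (centred t) N x / N) atTop (𝓝 0) := by
  rw [Metric.tendsto_atTop]
  intro ε hε
  obtain ⟨N₀, -, hN₀⟩ := exists_abs_birkhoffAverage_le (half_pos hε)
  refine ⟨N₀, fun N hN => ?_⟩
  rw [Real.dist_0_eq_abs]
  linarith [hN₀ t h0 h1 N hN x]

lemma uniformlyDistributed_orbit (x : UnitIco) :
    UniformlyDistributed (fun n : ℕ => T^[n] x) := by
  classical
  intro a b ha hab hb
  have hlim := ((tendsto_birkhoffSum_div (ha.trans hab.le) hb x).sub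
    (tendsto_birkhoffSum_div ha (hab.le.trans hb) x)).add_const (b - a)
  rw [sub_zero, zero_add] at hlim
  refine hlim.congr' ?_
  filter_upwards [eventually_gt_atTop 0] with N hN
  have hN' : (N : ℝ) ≠ 0 := by exact_mod_cast hN.ne'
  have hterm : ∀ z : UnitIco, (if (z : ℝ) ∈ Set.Ico a b then (1 : ℝ) else 0) =
      centred b z - centred a z + (b - a) := by
    intro z
    unfold centred
    by_cases h1 : (z : ℝ) < a
    · simp [h1, h1.trans hab]
    · by_cases h2 : (z : ℝ) < b
      · simp [h1, h2, not_lt.1 h1]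
      · simp [h1, h2]
  rw [Finset.card_filter, Nat.cast_sum]
  simp only [Nat.cast_ite, Nat.cast_one, Nat.cast_zero, hterm]
  rw [Finset.sum_add_distrib, Finset.sum_sub_distrib, Finset.sum_const, Finset.card_range,
    nsmul_eq_mul]
  change birkhoffSum T (centred b) N x / N - birkhoffSum T (centred a) N x / N + (b - a) =
    (birkhoffSum T (centred b) N x - birkhoffSum T (centred a) N x + N * (b - a)) / N
  field_simp

/-! ### Invariance of Lebesgue measure -/

lemma measurable_index : Measurable index := by
  refine measurable_to_countable' fun k => ?_
  have : index ⁻¹' {k} = {x | 1 ≤ k} ∩ Subtype.val ⁻¹' piece k := by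
    ext x
    refine ⟨?_, fun h => piece_unique (one_le_index x) h.1 (mem_piece_index x) h.2⟩
    rintro rfl
    exact ⟨one_le_index x, mem_piece_index x⟩
  rw [this]
  exact (MeasurableSet.const _).inter (measurable_subtype_coe measurableSet_Ico)

lemma measurable_T : Measurable T :=
  Measurable.subtype_mk ((measurable_subtype_coe.add
    ((measurable_from_nat (f := fun k => α ^ k)).comp measurable_index)).sub
      ((measurable_from_nat (f := leftEnd)).comp measurable_index))

lemma T_mem_Ico (x : UnitIco) : (T x : ℝ) ∈ Set.Ico (α ^ index x) (α ^ (index x - 1)) := by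
  obtain ⟨h1, h2⟩ := mem_piece_index x
  obtain ⟨k, hk⟩ := Nat.exists_eq_add_of_le' (one_le_index x)
  change (x : ℝ) + α ^ index x - leftEnd (index x) ∈ _
  rw [leftEnd_add_two] at h2
  rw [hk] at h1 h2 ⊢
  rw [Nat.add_sub_cancel]
  refine ⟨by linarith, ?_⟩
  rw [pow_succ, pow_succ] at h2
  rw [pow_succ]
  linear_combination h2 + α ^ k * α_sq

/-- Images of distinct pieces lie in the disjoint intervals `[α^k, α^(k-1)[`. -/
lemma index_eq_of_T_eq {x y : UnitIco} (h : T x = T y) : index x = index y := by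
  have key : ∀ {x y : UnitIco}, T x = T y → ¬ index x < index y := by
    intro x y h hlt
    have h1 := (T_mem_Ico x).1
    have h2 := (T_mem_Ico y).2
    rw [h] at h1
    have : α ^ (index y - 1) ≤ α ^ index x :=
      pow_le_pow_of_le_one α_pos.le α_lt_one.le (by omega)
    linarith
  exact le_antisymm (not_lt.1 (key h.symm)) (not_lt.1 (key h))

lemma lebesgue_apply (s : Set UnitIco) : lebesgue s = volume (Subtype.val '' s) :=
  comap_subtype_coe_apply measurableSet_Ico _ _

instance : IsProbabilityMeasure lebesgue :=
  ⟨by rw [lebesgue_apply, Set.image_univ, Subtype.range_coe, Real.volume_Ico]; norm_num⟩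

lemma lebesgue_preimage_T_le {s : Set UnitIco} (hs : MeasurableSet s) :
    lebesgue (T ⁻¹' s) ≤ lebesgue s := by
  set c : ℕ → ℝ := fun k => leftEnd k - α ^ k with hc
  set E : ℕ → Set UnitIco := fun k => T ⁻¹' s ∩ index ⁻¹' {k} with hE
  -- `F k` is the image of `E k` under `T`, viewed in `ℝ`: a translate of `E k`.
  set F : ℕ → Set ℝ := fun k => (fun z => z + c k) ⁻¹' (Subtype.val '' E k) with hF
  have hEm : ∀ k, MeasurableSet (E k) := fun k =>
    (measurable_T hs).inter (measurable_index (measurableSet_singleton k))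
  have hFm : ∀ k, MeasurableSet (F k) := fun k =>
    (measurable_add_const _) (measurableSet_Ico.subtype_image (hEm k))
  have hFT : ∀ {k z}, z ∈ F k → ∃ x, T x ∈ s ∧ index x = k ∧ (T x : ℝ) = z := by
    rintro k z ⟨x, ⟨hxs, rfl⟩, hx⟩
    refine ⟨x, hxs, rfl, ?_⟩
    change (x : ℝ) + α ^ index x - leftEnd (index x) = z
    rw [hx]
    simp only [hc]
    ring
  have hdisj : Pairwise (Function.onFun Disjoint F) := by
    intro k l hkl
    refine Set.disjoint_left.2 fun z hk hl => hkl ?_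
    obtain ⟨x, -, rfl, hx⟩ := hFT hk
    obtain ⟨y, -, rfl, hy⟩ := hFT hl
    exact index_eq_of_T_eq (Subtype.ext (hx.trans hy.symm))
  have hcover : T ⁻¹' s = ⋃ k, E k := by
    ext x
    simp [hE]
  calc lebesgue (T ⁻¹' s) ≤ ∑' k, lebesgue (E k) := by
        rw [hcover]
        exact measure_iUnion_le _
    _ = ∑' k, volume (F k) := by simp only [lebesgue_apply, hF, measure_preimage_add_right]
    _ = volume (⋃ k, F k) := (measure_iUnion hdisj hFm).symm
    _ ≤ lebesgue s := by
        rw [lebesgue_apply]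
        refine measure_mono (Set.iUnion_subset fun k z hz => ?_)
        obtain ⟨x, hxs, -, hx⟩ := hFT hz
        exact ⟨T x, hxs, hx⟩

lemma measurePreserving_T : MeasurePreserving T lebesgue lebesgue := by
  refine ⟨measurable_T, ?_⟩
  have := Measure.isProbabilityMeasure_map (μ := lebesgue) measurable_T.aemeasurable
  -- Between probability measures an inequality is an equality, so surjectivity of `T` need not be
  -- examined.
  refine Measure.eq_of_le_of_isProbabilityMeasure (Measure.le_iff.2 fun s hs => ?_)
  rw [Measure.map_apply measurable_T hs]
  exact lebesgue_preimage_T_le hs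

/-! ### Uniqueness of the invariant measure -/

lemma measurableSet_lt (t : ℝ) : MeasurableSet {x : UnitIco | (x : ℝ) < t} :=
  measurable_subtype_coe measurableSet_Iio

lemma measurable_centred (t : ℝ) : Measurable (centred t) :=
  (Measurable.ite (measurableSet_lt t) measurable_const measurable_const).sub_const _

/-- Invariance lets the integrand be replaced by its Birkhoff averages, which are uniformly small.
-/
lemma integral_centred_eq_zero {μ : Measure UnitIco} [IsProbabilityMeasure μ]
    (hμ : MeasurePreserving T μ μ) {t : ℝ} (h0 : 0 ≤ t) (h1 : t ≤ 1) :
    ∫ x, centred t x ∂μ = 0 := by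
  have hmeas := measurable_centred t
  have hterm : ∀ n : ℕ, ∫ x, centred t (T^[n] x) ∂μ = ∫ x, centred t x ∂μ := fun n => by
    have h := hμ.iterate n
    rw [← integral_map h.measurable.aemeasurable hmeas.aestronglyMeasurable, h.map_eq]
  have hint : ∀ n : ℕ, Integrable (fun x => centred t (T^[n] x)) μ := fun n =>
    Integrable.of_bound (hmeas.comp (hμ.iterate n).measurable).aestronglyMeasurable 1
      (Eventually.of_forall fun x => abs_centred_le h0 h1 _)
  have hsum : ∀ N : ℕ, ∫ x, birkhoffSum T (centred t) N x ∂μ = N * ∫ x, centred t x ∂μ := by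
    intro N
    simp only [birkhoffSum]
    rw [integral_finsetSum _ fun n _ => hint n]
    simp [hterm]
  rw [← abs_eq_zero]
  refine le_antisymm (le_of_forall_pos_le_add fun ε hε => ?_) (abs_nonneg _)
  obtain ⟨N, hN, h⟩ := exists_abs_birkhoffAverage_le hε
  have hN' : (N : ℝ) ≠ 0 := by exact_mod_cast hN.ne'
  have heq : ∫ x, centred t x ∂μ = ∫ x, birkhoffSum T (centred t) N x / N ∂μ := by
    rw [integral_div, hsum, mul_div_cancel_left₀ _ hN']
  have hle := norm_integral_le_of_norm_le_const (μ := μ) (C := ε)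
    (f := fun x => birkhoffSum T (centred t) N x / N) (Eventually.of_forall fun x => h t h0 h1 N le_rfl x)
  rw [heq, zero_add]
  simpa using hle

lemma measureReal_lt {μ : Measure UnitIco} [IsProbabilityMeasure μ]
    (hμ : MeasurePreserving T μ μ) {t : ℝ} (h0 : 0 ≤ t) (h1 : t ≤ 1) :
    μ.real {x : UnitIco | (x : ℝ) < t} = t := by
  have h := integral_centred_eq_zero hμ h0 h1
  have hind : ∀ x, centred t x = {x : UnitIco | (x : ℝ) < t}.indicator (fun _ => (1 : ℝ)) x - t := fun x => by
    simp [centred, Set.indicator_apply]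
  simp only [hind] at h
  rw [integral_sub ((integrable_const (1 : ℝ)).indicator (measurableSet_lt t))
    (integrable_const t), integral_indicator_const _ (measurableSet_lt t)] at h
  simpa [sub_eq_zero] using h

/-- Lebesgue measure is the only invariant probability measure. -/
lemma eq_lebesgue {μ : Measure UnitIco} [IsProbabilityMeasure μ]
    (hμ : MeasurePreserving T μ μ) : μ = lebesgue := by
  have hlt : ∀ t : ℝ, μ {x : UnitIco | (x : ℝ) < t} = lebesgue {x : UnitIco | (x : ℝ) < t} := by
    intro t
    have hclamp : {x : UnitIco | (x : ℝ) < t} = {x : UnitIco | (x : ℝ) < max 0 (min t 1)} := by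
      ext x
      simp [x.2.1.not_gt, x.2.2]
    have h0 : 0 ≤ max 0 (min t 1) := le_max_left _ _
    have h1 : max 0 (min t 1) ≤ 1 := max_le zero_le_one (min_le_right _ _)
    rw [hclamp, ← measureReal_eq_measureReal_iff, measureReal_lt hμ h0 h1,
      measureReal_lt measurePreserving_T h0 h1]
  have hemb : MeasurableEmbedding (Subtype.val : UnitIco → ℝ) :=
    MeasurableEmbedding.subtype_coe measurableSet_Ico
  have hmap : μ.map Subtype.val = lebesgue.map Subtype.val := by
    have := Measure.isProbabilityMeasure_map (μ := μ) hemb.measurable.aemeasurable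
    refine Measure.ext_of_Ici _ _ fun t => ?_
    rw [hemb.map_apply, hemb.map_apply]
    have hcompl : (Subtype.val : UnitIco → ℝ) ⁻¹' Set.Ici t = {x : UnitIco | (x : ℝ) < t}ᶜ := by
      ext x
      simp
    rw [hcompl, prob_compl_eq_one_sub (measurableSet_lt t),
      prob_compl_eq_one_sub (measurableSet_lt t), hlt]
  rw [← hemb.comap_map μ, hmap, hemb.comap_map]

lemma invariantMeasures_T : invariantMeasures T = {lebesgue} := by
  ext μ
  refine ⟨fun ⟨_, h⟩ => eq_lebesgue h, ?_⟩
  rintro rfl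
  exact ⟨inferInstance, measurePreserving_T⟩

end KakutaniFibonacci

/-- The Kakutani–Fibonacci transformation of `[0,1[` is uniquely ergodic, its only invariant
probability measure being Lebesgue measure, and the orbit of every point is uniformly
distributed. -/
theorem theorem4p4 :
    KakutaniFibonacci.UniquelyErgodic KakutaniFibonacci.T ∧
      KakutaniFibonacci.lebesgue ∈ KakutaniFibonacci.invariantMeasures KakutaniFibonacci.T ∧
      ∀ x : KakutaniFibonacci.UnitIco,
        KakutaniFibonacci.UniformlyDistributed (fun n : ℕ => KakutaniFibonacci.T^[n] x) := by
  refine ⟨⟨_, KakutaniFibonacci.invariantMeasures_T⟩, ?_,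
    KakutaniFibonacci.uniformlyDistributed_orbit⟩
  rw [KakutaniFibonacci.invariantMeasures_T]
  rfl
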